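/- Let $f:\mathbb R^n\to\mathbb R$, $c:\mathbb R^n\to\mathbb R^p$, $A\in\mathbb R^{q\times n}$, $B\in\mathbb R^{q\times m}$, $b\in\mathbb R^q$, and consider the problem $$\min_{x,y} f(x)\quad\text{s.t.}\quad c(x)=0,\ Ax+By=b. \tag{P}$$ $\|\cdot\|$ is the Euclidean norm (also of stacked vectors), and $\nabla c(x)^{\mathrm T}$ is the Jacobian of $c$. For $\rho>0$, ADMM (run without its stopping test) starts from $y^0,\lambda^0$ with $B^{\mathrm T}\lambda^0=0$ and for $k=0,1,2,\dots$ finds a local minimum $x^{k+1}$ of the subproblem $$\min_x\ f(x)+(\lambda^k)^{\mathrm T}(Ax+By^k-b)+\tfrac\rho2\|Ax+By^k-b\|^2\quad\text{s.t. } c(x)=0, \tag{SP$_k$}$$ takes $y^{k+1}\in\arg\min_y\{(\lambda^k)^{\mathrm T}(Ax^{k+1}+By-b)+\tfrac\rho2\|Ax^{k+1}+By-b\|^2\}$, and sets $\lambda^{k+1}=\lambda^k+\rho(Ax^{k+1}+By^{k+1}-b)$. Assumption 1 (KKT iterates). $f,c$ are continuously differentiable, and for every $k$ a KKT point $(x^{k+1},\mu^{k+1})$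 of (SP$_k$) is found: $\nabla f(x^{k+1})+\nabla c(x^{k+1})\mu^{k+1}+A^{\mathrm T}(\lambda^k+\rho(Ax^{k+1}+By^k-b))=0$ and $c(x^{k+1})=0$. Assumption 2 (overall regularity). $f,c$ are continuously differentiable on $\mathbb R^n$ and twice continuously differentiable near $x^*$; $(x^*,y^*,\mu^*,\lambda^*)$ is a KKT point of (P), i.e. $\nabla f(x^*)+\nabla c(x^*)\mu^*+A^{\mathrm T}\lambda^*=0$, $B^{\mathrm T}\lambda^*=0$, $c(x^*)=0$, $Ax^*+By^*=b$; the rows of $C=\begin{bmatrix}\nabla c(x^*)^{\mathrm T}&0\\A&B\end{bmatrix}$ are linearly independent; and, with $H=\nabla^2f(x^*)+\sum_j\mu^*_j\nabla^2c_j(x^*)$, one has $z^{\mathrm T}\begin{bmatrix}H&0\\0&0\end{bmatrix}z>0$ for all $z\ne0$ with $Cz=0$. Assumption 3 (nearest solution). For every $k$, $(x^{k+1},\mu^{k+1})$ is a local minimizer/multiplier pair of (SP$_k$) (the first component is a local minimum, and the pair is a KKT point) and, among all such pairs, one closest to $(x^*,\mu^*)$. Put $\|(y,\lambda)\|_\rho=\bigl(\rho\|By\|^2+\tfrac1\rho\|\lambda\|^2\bigr)^{1/2}$.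 Corollary. Let Assumption 2 hold. There is a constant $\rho^*>0$, and for every $\rho>\rho^*$ there is a constant $\epsilon'>0$, such that for every sequence of ADMM iterates with penalty parameter $\rho$ that satisfies Assumptions 1 and 3: if $\|(y^K,\lambda^K)-(y^*,\lambda^*)\|<\epsilon'$ for some $K$, then the errors $e_k=\|(y^k,\lambda^k)-(y^*,\lambda^*)\|_\rho$ converge to zero, satisfy $e_{k+1}\le e_k$ for all $k\ge K$, and converge either in finitely many iterations ($e_k=0$ for all sufficiently large $k$) or Q-sublinearly, in the sense that $e_k\neq0$ and $e_{k+1}/e_k\le1$ for all $k\ge K$. -/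

import Mathlib

open Filter Topology

noncomputable section

namespace ADMM

/-- `ℝᵈ` with the Euclidean norm. -/
abbrev Vec (d : ℕ) : Type := EuclideanSpace ℝ (Fin d)

/-- The matrix-vector product `M v`, as a map between Euclidean spaces. -/
def mulV {a d : ℕ} (M : Matrix (Fin a) (Fin d) ℝ) (v : Vec d) : Vec a :=
  WithLp.toLp 2 (M.mulVec v.ofLp)

/-- The Euclidean norm of the stacked vector `(u, v)`. -/
def pairNorm {a d : ℕ} (u : Vec a) (v : Vec d) : ℝ :=
  ‖(WithLp.toLp 2 (u, v) : WithLp 2 (Vec a × Vec d))‖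

/-- The data of the problem
`min_{x, y} f x` subject to `c x = 0` and `A x + B y = b`. -/
structure Problem (n m p q : ℕ) where
  f : Vec n → ℝ
  c : Vec n → Vec p
  A : Matrix (Fin q) (Fin n) ℝ
  B : Matrix (Fin q) (Fin m) ℝ
  b : Vec q

/-- The Hessian matrix of `g` at `x`. -/
def hessian {n : ℕ} (g : Vec n → ℝ) (x : Vec n) : Matrix (Fin n) (Fin n) ℝ :=
  Matrix.of fun i j =>
    fderiv ℝ (fderiv ℝ g) x (EuclideanSpace.single i 1) (EuclideanSpace.single j 1)

namespace Problem

variable {n m p q : ℕ} (P : Problem n m p q)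

/-- The gradient of the component `c_j` at `x`. -/
def gradC (x : Vec n) (j : Fin p) : Vec n :=
  gradient (fun u => P.c u j) x

/-- `∇c(x) μ`, where `∇c(x)` is the transpose of the Jacobian of `c`. -/
def gradCMul (x : Vec n) (mu : Vec p) : Vec n :=
  ∑ j, mu j • P.gradC x j

/-- `A x + B y - b`. -/
def residual (x : Vec n) (y : Vec m) : Vec q :=
  mulV P.A x + mulV P.B y - P.b

/-- `λᵀ (A x + B y - b) + (ρ / 2) ‖A x + B y - b‖²`. -/
def augTerm (ρ : ℝ) (lam : Vec q) (x : Vec n) (y : Vec m) : ℝ :=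
  inner ℝ lam (P.residual x y) + ρ / 2 * ‖P.residual x y‖ ^ 2

/-- `(x, y, μ, λ)` is a KKT point of the problem. -/
structure IsKKT (x : Vec n) (y : Vec m) (mu : Vec p) (lam : Vec q) : Prop where
  stat_x : gradient P.f x + P.gradCMul x mu + mulV P.A.transpose lam = 0
  stat_y : mulV P.B.transpose lam = 0
  feas_c : P.c x = 0
  feas_lin : mulV P.A x + mulV P.B y = P.b

/-- The feasible set `{x | c x = 0}` of the subproblem. -/
def spFeasible : Set (Vec n) := {x | P.c x = 0}

/-- The objective of the subproblem (in the variable `x`) with parameters `y`, `λ`. -/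
def spObj (ρ : ℝ) (y : Vec m) (lam : Vec q) (x : Vec n) : ℝ :=
  P.f x + P.augTerm ρ lam x y

/-- `x` is a local minimum of the subproblem with parameters `y`, `λ`. -/
def IsSPLocalMin (ρ : ℝ) (y : Vec m) (lam : Vec q) (x : Vec n) : Prop :=
  x ∈ P.spFeasible ∧ IsLocalMinOn (P.spObj ρ y lam) P.spFeasible x

/-- `(x, μ)` is a KKT point of the subproblem with parameters `y`, `λ`. -/
structure IsSPKKT (ρ : ℝ) (y : Vec m) (lam : Vec q) (x : Vec n) (mu : Vec p) : Prop where
  stat : gradient P.f x + P.gradCMul x mu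
    + mulV P.A.transpose (lam + ρ • P.residual x y) = 0
  feas : P.c x = 0

/-- `x` is a local minimizer of the subproblem, and `μ` is a multiplier for it. -/
def IsSPMinMultiplier (ρ : ℝ) (y : Vec m) (lam : Vec q) (x : Vec n) (mu : Vec p) : Prop :=
  P.IsSPLocalMin ρ y lam x ∧ P.IsSPKKT ρ y lam x mu

/-- The sequences are iterates of ADMM with penalty parameter `ρ` (run without the stopping
test). The entries `x 0` and `mu 0` play no role. -/
structure IsADMM (ρ : ℝ) (x : ℕ → Vec n) (y : ℕ → Vec m) (lam : ℕ → Vec q) : Prop where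
  init : mulV P.B.transpose (lam 0) = 0
  x_step : ∀ k, P.IsSPLocalMin ρ (y k) (lam k) (x (k + 1))
  y_step : ∀ k, IsMinOn (fun v => P.augTerm ρ (lam k) (x (k + 1)) v) Set.univ (y (k + 1))
  lam_step : ∀ k, lam (k + 1) = lam k + ρ • P.residual (x (k + 1)) (y (k + 1))

/-- A KKT point `(x (k + 1), mu (k + 1))` of the subproblem is found at every iteration. -/
def KKTIterates (ρ : ℝ) (x : ℕ → Vec n) (y : ℕ → Vec m) (mu : ℕ → Vec p)
    (lam : ℕ → Vec q) : Prop :=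
  ∀ k, P.IsSPKKT ρ (y k) (lam k) (x (k + 1)) (mu (k + 1))

/-- At every iteration, `(x (k + 1), mu (k + 1))` is a local minimizer/multiplier pair for the
subproblem, and among all such pairs it is closest to `(xs, mus)`. -/
def NearestSolution (ρ : ℝ) (xs : Vec n) (mus : Vec p) (x : ℕ → Vec n) (y : ℕ → Vec m)
    (mu : ℕ → Vec p) (lam : ℕ → Vec q) : Prop :=
  ∀ k, P.IsSPMinMultiplier ρ (y k) (lam k) (x (k + 1)) (mu (k + 1)) ∧
    ∀ (x' : Vec n) (mu' : Vec p), P.IsSPMinMultiplier ρ (y k) (lam k) x' mu' →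
      pairNorm (x (k + 1) - xs) (mu (k + 1) - mus) ≤ pairNorm (x' - xs) (mu' - mus)

/-- The Jacobian `[∇c(x)ᵀ, 0; A, B]` of all the constraints. -/
def constraintJacobian (x : Vec n) : Matrix (Fin p ⊕ Fin q) (Fin n ⊕ Fin m) ℝ :=
  Matrix.fromBlocks (Matrix.of fun j i => P.gradC x j i) 0 P.A P.B

/-- `H_xx(x, μ) = ∇²f(x) + ∑ j, μ_j ∇²c_j(x)`. -/
def lagrangianHessian (x : Vec n) (mu : Vec p) : Matrix (Fin n) (Fin n) ℝ :=
  hessian P.f x + ∑ j, mu j • hessian (fun u => P.c u j) x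

/-- `(x, y, μ, λ)` is a KKT point at which the linear independence constraint qualification and
the second order sufficient conditions hold. -/
structure OverallRegularity (x : Vec n) (y : Vec m) (mu : Vec p) (lam : Vec q) : Prop where
  contDiff_f : ContDiff ℝ 1 P.f
  contDiff_c : ContDiff ℝ 1 P.c
  kkt : P.IsKKT x y mu lam
  twice : ∃ U : Set (Vec n), IsOpen U ∧ x ∈ U ∧ ContDiffOn ℝ 2 P.f U ∧ ContDiffOn ℝ 2 P.c U
  licq : LinearIndependent ℝ (P.constraintJacobian x).row
  sosc : ∀ z : Fin n ⊕ Fin m → ℝ, z ≠ 0 → (P.constraintJacobian x).mulVec z = 0 →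
    0 < z ⬝ᵥ (Matrix.fromBlocks (P.lagrangianHessian x mu) 0 0 0 :
      Matrix (Fin n ⊕ Fin m) (Fin n ⊕ Fin m) ℝ).mulVec z

/-- `‖(y, λ)‖_ρ = (ρ ‖B y‖² + ‖λ‖² / ρ) ^ (1/2)`. -/
def rhoNorm (ρ : ℝ) (y : Vec m) (lam : Vec q) : ℝ :=
  Real.sqrt (ρ * ‖mulV P.B y‖ ^ 2 + 1 / ρ * ‖lam‖ ^ 2)

end Problem

/-- The error sequence `e` reaches zero after finitely many iterations and stays there. -/
def ConvergesInFinitelyMany (e : ℕ → ℝ) : Prop :=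
  ∃ N, ∀ k ≥ N, e k = 0

/-- From index `K` on, the error sequence `e` converges to zero Q-sublinearly: the errors are
nonzero, they converge to zero, and the quotients of successive errors are at most `1`. -/
def ConvergesQSublinearlyFrom (K : ℕ) (e : ℕ → ℝ) : Prop :=
  Tendsto e atTop (𝓝 0) ∧ ∀ k ≥ K, e k ≠ 0 ∧ e (k + 1) / e k ≤ 1

end ADMM

end

/-! The squared error `e_k²` is a Lyapunov function near the solution. By compactness, the second
order condition becomes a penalized inequality `α‖d‖² ≤ curvature + σ(‖c'(x*)d‖² + ‖Ad + Bz‖²)`, and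
the threshold is `ρ* = 2σ`.

For a KKT point of the subproblem, the multiplier update turns stationarity into the stationarity
condition of the full problem at the new multiplier, perturbed by `ρ Aᵀ B(y' - y)`. Subtract the
exact condition at the solution and pair with `x - x*`. On one side, feasibility of `x` and the
penalized inequality give a lower bound; on the other, `Bᵀλ = 0` removes all cross terms between
multipliers and images of `B`, and polarization leaves differences of squares. The result
(`eventually_descent`) is that `e²` drops by at least `α‖x - x*‖² + ρ‖B(y' - y)‖² + (1/ρ - 2σ/ρ²)‖λ'
- λ‖²`, and the last coefficient is positive exactly when `ρ > 2σ`.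

This holds only while `(x, μ)` stays near `(x*, μ*)`. A perturbation argument
(`eventually_exists_minMultiplier`) shows that the subproblem has some minimizer/multiplier pair
there whenever `(y, λ)` is near `(y*, λ*)`; the nearest-solution rule then forces the computed pair
to be there too. The error does not grow, so the iterates never leave the neighbourhood.

Telescoping makes all the decrements vanish: `x → x*` and the increments of `By` and `λ` tend to
zero. The linear constraint gives `By → By*`, and constraint independence gives `λ → λ*`
(`tendsto_rhoNorm_zero`). -/

namespace ADMM

/-! ### Finsler's lemma and Taylor estimates -/

section General

/-- Finsler's lemma for continuous 2-homogeneous functions: if `Q` is positive on the nonzero zeros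
of the nonnegative function `T`, then `Q + σ T` is uniformly positive for some `σ`. -/
theorem exists_penalty_of_pos_on_zeros {E : Type*} [NormedAddCommGroup E] [NormedSpace ℝ E]
    [FiniteDimensional ℝ E] {Q T : E → ℝ} (hQ : Continuous Q) (hT : Continuous T)
    (hQh : ∀ (t : ℝ) (w : E), Q (t • w) = t ^ 2 * Q w)
    (hTh : ∀ (t : ℝ) (w : E), T (t • w) = t ^ 2 * T w) (hT0 : ∀ w, 0 ≤ T w)
    (hpos : ∀ w, w ≠ 0 → T w = 0 → 0 < Q w) :
    ∃ σ α : ℝ, 0 < σ ∧ 0 < α ∧ ∀ w, α * ‖w‖ ^ 2 ≤ Q w + σ * T w := by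
  have hS : IsCompact (Metric.sphere (0 : E) 1) := isCompact_sphere _ _
  -- The sets where `Q + (N + 1) T` is positive are open, increase with `N` and cover the unit
  -- sphere, so a single one covers it; `N + 1` instead of `N` keeps the penalty positive.
  obtain ⟨N, hN⟩ := hS.elim_directed_cover (fun N : ℕ => {w | 0 < Q w + (N + 1 : ℝ) * T w})
    (fun N => isOpen_lt continuous_const (hQ.add (continuous_const.mul hT)))
    (by
      intro w hw
      have hw0 : w ≠ 0 := by
        rintro rfl
        simp at hw
      rw [Set.mem_iUnion]
      rcases (hT0 w).eq_or_lt with h | h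
      · exact ⟨0, by simpa [← h] using hpos w hw0 h.symm⟩
      · obtain ⟨N, hN⟩ := exists_nat_gt (-Q w / T w)
        refine ⟨N, ?_⟩
        rw [div_lt_iff₀ h] at hN
        simp only [Set.mem_ofPred_eq]
        nlinarith)
    (directed_of_isDirected_le (by
      intro M N hMN w hw
      simp only [Set.mem_ofPred_eq] at hw ⊢
      have hMN' : (M : ℝ) ≤ N := by exact_mod_cast hMN
      nlinarith [mul_le_mul_of_nonneg_right hMN' (hT0 w)]))
  obtain ⟨α, hα, hle⟩ := hS.exists_forall_le' (a := 0)
    (f := fun w => Q w + (N + 1 : ℝ) * T w)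
    (hQ.add (continuous_const.mul hT)).continuousOn hN
  refine ⟨N + 1, α, by positivity, hα, fun w => ?_⟩
  rcases eq_or_ne w 0 with rfl | hw
  · have h1 := hQh 0 0
    have h2 := hTh 0 0
    rw [zero_smul, zero_pow two_ne_zero, zero_mul] at h1 h2
    simp [h1, h2]
  · have hn : ‖w‖ ≠ 0 := norm_ne_zero_iff.2 hw
    have := hle (‖w‖⁻¹ • w) (by simp [norm_smul, hn])
    rw [hQh, hTh] at this
    have h2 := mul_le_mul_of_nonneg_left this (sq_nonneg ‖w‖)
    have e : ‖w‖ ^ 2 * (‖w‖⁻¹ ^ 2 * Q w + (N + 1 : ℝ) * (‖w‖⁻¹ ^ 2 * T w))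
        = Q w + (N + 1 : ℝ) * T w := by
      field_simp
    rw [e] at h2
    linarith

/-- The second order Taylor estimate at a point where the derivative is differentiable. -/
theorem taylor_two_isLittleO {E : Type*} [NormedAddCommGroup E] [NormedSpace ℝ E] {g : E → ℝ}
    {a : E} (hg : Differentiable ℝ g) (hg2 : DifferentiableAt ℝ (fderiv ℝ g) a) {ε : ℝ}
    (hε : 0 < ε) :
    ∀ᶠ x in 𝓝 a, |g x - g a - fderiv ℝ g a (x - a)
      - 1 / 2 * fderiv ℝ (fderiv ℝ g) a (x - a) (x - a)| ≤ ε * ‖x - a‖ ^ 2 := by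
  have h := hg2.hasFDerivAt.isLittleO.def hε
  obtain ⟨r, hr, hball⟩ := Metric.eventually_nhds_iff_ball.1 h
  filter_upwards [Metric.ball_mem_nhds a hr] with x hx
  set d := x - a with hd
  -- The Taylor remainder along the segment: differentiability of `fderiv ℝ g` at `a` bounds its
  -- derivative by `ε‖d‖²`, and the mean value inequality finishes.
  let φ : ℝ → ℝ := fun t => g (a + t • d) - t * fderiv ℝ g a d
    - t ^ 2 / 2 * fderiv ℝ (fderiv ℝ g) a d d
  have hline : ∀ t : ℝ, HasDerivAt (fun t : ℝ => a + t • d) d t := fun t => by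
    simpa using ((hasDerivAt_id t).smul_const d).const_add a
  have hφ : ∀ t : ℝ, HasDerivAt φ (fderiv ℝ g (a + t • d) d - fderiv ℝ g a d
      - t * fderiv ℝ (fderiv ℝ g) a d d) t := fun t => by
    have h1 : HasDerivAt (fun t : ℝ => g (a + t • d)) (fderiv ℝ g (a + t • d) d) t :=
      (hg (a + t • d)).hasFDerivAt.comp_hasDerivAt t (hline t)
    have h2 := ((hasDerivAt_id t).mul_const (fderiv ℝ g a d))
    have h3 := (((hasDerivAt_id t).pow 2).div_const 2).mul_const (fderiv ℝ (fderiv ℝ g) a d d)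
    exact ((h1.sub h2).sub h3).congr_deriv (by norm_num)
  have hbound : ∀ t ∈ Set.Icc (0 : ℝ) 1, ‖fderiv ℝ g (a + t • d) d - fderiv ℝ g a d
      - t * fderiv ℝ (fderiv ℝ g) a d d‖ ≤ ε * ‖d‖ ^ 2 := by
    intro t ht
    have hmem : a + t • d ∈ Metric.ball a r := by
      rw [mem_ball_iff_norm] at hx ⊢
      rw [add_sub_cancel_left, norm_smul, Real.norm_of_nonneg ht.1]
      exact lt_of_le_of_lt (mul_le_of_le_one_left (norm_nonneg _) ht.2) hx
    have h1 := hball _ hmem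
    rw [add_sub_cancel_left] at h1
    have h2 := (fderiv ℝ g (a + t • d) - fderiv ℝ g a
      - fderiv ℝ (fderiv ℝ g) a (t • d)).le_opNorm d
    have h3 : ‖t • d‖ ≤ ‖d‖ := by
      rw [norm_smul, Real.norm_of_nonneg ht.1]
      exact mul_le_of_le_one_left (norm_nonneg _) ht.2
    simp only [map_smul, sub_apply, smul_apply,
      smul_eq_mul] at h2
    refine h2.trans ?_
    rw [map_smul] at h1
    calc _ ≤ (ε * ‖d‖) * ‖d‖ := by gcongr; exact h1.trans (by gcongr)
      _ = _ := by ring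
  have := (convex_Icc (0 : ℝ) 1).norm_image_sub_le_of_norm_hasDerivWithin_le
    (fun t _ => (hφ t).hasDerivWithinAt) hbound (Set.left_mem_Icc.2 zero_le_one)
    (Set.right_mem_Icc.2 zero_le_one)
  simp only [φ, one_smul, zero_smul, Real.norm_eq_abs] at this
  rw [hd, add_sub_cancel, ← hd] at this
  rw [add_zero, sub_zero, abs_one, mul_one] at this
  refine le_trans (le_of_eq ?_) this
  congr 1
  ring

/-- If the derivative of `g` is locally Lipschitz at `a`, the linearization error at a nearby point
is quadratic. -/
theorem exists_linearization_bound {E F : Type*} [NormedAddCommGroup E] [NormedSpace ℝ E]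
    [NormedAddCommGroup F] [NormedSpace ℝ F] {g : E → F} {a : E} (hg : Differentiable ℝ g)
    (hg2 : ContDiffAt ℝ 1 (fderiv ℝ g) a) :
    ∃ M : ℝ, 0 ≤ M ∧ ∀ᶠ x in 𝓝 a, ‖g a - g x - fderiv ℝ g x (a - x)‖ ≤ M * ‖x - a‖ ^ 2 := by
  obtain ⟨k, t, ht, hk⟩ := hg2.exists_lipschitzOnWith
  obtain ⟨r, hr, hball⟩ := Metric.mem_nhds_iff.1 ht
  refine ⟨k, k.2, ?_⟩
  filter_upwards [Metric.ball_mem_nhds a hr] with x hx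
  have hseg : segment ℝ x a ⊆ Metric.ball a r :=
    (convex_ball a r).segment_subset hx (Metric.mem_ball_self hr)
  have := (convex_segment x a).norm_image_sub_le_of_norm_hasFDerivWithin_le'
    (C := k * ‖x - a‖) (φ := fderiv ℝ g x)
    (fun z _ => (hg z).hasFDerivAt.hasFDerivWithinAt)
    (fun z hz => by
      refine (hk.norm_sub_le (hball (hseg hz)) (hball hx)).trans ?_
      gcongr
      rw [norm_sub_rev x a]
      exact norm_sub_le_of_mem_segment hz)
    (left_mem_segment ℝ x a) (right_mem_segment ℝ x a)
  rw [norm_sub_rev a x] at this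
  linarith [this]

end General

/-! ### Matrix products, stacked norms and derivatives of the Lagrangian -/

section MulV

variable {a d : ℕ} (M : Matrix (Fin a) (Fin d) ℝ)

/-- `v ↦ M v` as a continuous linear map. -/
noncomputable def mulL : Vec d →L[ℝ] Vec a := LinearMap.toContinuousLinearMap (Matrix.toEuclideanLin M)

theorem mulL_apply (v : Vec d) : mulL M v = mulV M v := rfl

theorem mulV_sub (v w : Vec d) : mulV M (v - w) = mulV M v - mulV M w := (mulL M).map_sub v w

theorem mulV_smul (t : ℝ) (v : Vec d) : mulV M (t • v) = t • mulV M v := (mulL M).map_smul t v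

theorem mulV_zero : mulV M 0 = 0 := (mulL M).map_zero

@[fun_prop]
theorem continuous_mulV : Continuous (mulV M) := (mulL M).continuous

theorem inner_eq_dotProduct (v w : Vec d) : inner ℝ v w = v.ofLp ⬝ᵥ w.ofLp := by
  simp [PiLp.inner_apply, dotProduct, mul_comm]

theorem inner_mulV_transpose (w : Vec a) (v : Vec d) :
    inner ℝ (mulV M.transpose w) v = inner ℝ w (mulV M v) := by
  rw [inner_eq_dotProduct, inner_eq_dotProduct]
  simp [mulV, Matrix.mulVec_transpose, Matrix.dotProduct_mulVec]

end MulV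

theorem pairNorm_sq {a d : ℕ} (u : Vec a) (v : Vec d) : pairNorm u v ^ 2 = ‖u‖ ^ 2 + ‖v‖ ^ 2 := by
  simp [pairNorm, WithLp.prod_norm_sq_eq_of_L2]

theorem pairNorm_nonneg {a d : ℕ} (u : Vec a) (v : Vec d) : 0 ≤ pairNorm u v := norm_nonneg _

theorem norm_left_le_pairNorm {a d : ℕ} (u : Vec a) (v : Vec d) : ‖u‖ ≤ pairNorm u v :=
  le_of_sq_le_sq (by rw [pairNorm_sq]; nlinarith [sq_nonneg ‖v‖]) (pairNorm_nonneg u v)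

theorem norm_right_le_pairNorm {a d : ℕ} (u : Vec a) (v : Vec d) : ‖v‖ ≤ pairNorm u v :=
  le_of_sq_le_sq (by rw [pairNorm_sq]; nlinarith [sq_nonneg ‖u‖]) (pairNorm_nonneg u v)

theorem pairNorm_le_add {a d : ℕ} (u : Vec a) (v : Vec d) : pairNorm u v ≤ ‖u‖ + ‖v‖ :=
  le_of_sq_le_sq (by rw [pairNorm_sq]; nlinarith [norm_nonneg u, norm_nonneg v])
    (by positivity)

theorem dotProduct_hessian {n : ℕ} (g : Vec n → ℝ) (x d : Vec n) :
    d.ofLp ⬝ᵥ (hessian g x).mulVec d.ofLp = fderiv ℝ (fderiv ℝ g) x d d := by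
  have hd : d = ∑ i, d i • EuclideanSpace.single i (1 : ℝ) := by
    simpa using ((EuclideanSpace.basisFun (Fin n) ℝ).sum_repr d).symm
  conv_rhs => rw [hd]
  simp only [map_sum, map_smul, sum_apply, smul_apply,
    smul_eq_mul, dotProduct, Matrix.mulVec, hessian, Matrix.of_apply, Finset.mul_sum]
  rw [Finset.sum_comm]
  refine Finset.sum_congr rfl fun i _ => Finset.sum_congr rfl fun j _ => ?_
  ring

namespace Problem

variable {n m p q : ℕ} (P : Problem n m p q)

/-- The Lagrangian of the nonlinear part of the problem. -/
noncomputable def lagr (mu : Vec p) (x : Vec n) : ℝ := P.f x + inner ℝ mu (P.c x)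

/-- Its gradient. -/
noncomputable def lagrGrad (x : Vec n) (mu : Vec p) : Vec n := gradient P.f x + P.gradCMul x mu

variable {P}

theorem fderiv_c_apply {x : Vec n} (hc : DifferentiableAt ℝ P.c x) (j : Fin p) (d : Vec n) :
    fderiv ℝ (fun u => P.c u j) x d = fderiv ℝ P.c x d j := by
  have : HasFDerivAt (fun u => P.c u j) ((EuclideanSpace.proj j).comp (fderiv ℝ P.c x)) x :=
    (EuclideanSpace.proj (𝕜 := ℝ) j).hasFDerivAt.comp x hc.hasFDerivAt
  rw [this.fderiv]
  rfl

theorem gradC_inner {x : Vec n} (hc : DifferentiableAt ℝ P.c x) (j : Fin p) (d : Vec n) :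
    inner ℝ (P.gradC x j) d = fderiv ℝ P.c x d j := by
  rw [gradC, inner_gradient_left, fderiv_c_apply hc]

theorem inner_gradCMul {x : Vec n} (hc : DifferentiableAt ℝ P.c x) (mu : Vec p) (d : Vec n) :
    inner ℝ (P.gradCMul x mu) d = inner ℝ mu (fderiv ℝ P.c x d) := by
  simp only [gradCMul, sum_inner, inner_smul_left, gradC_inner hc]
  simp [PiLp.inner_apply, mul_comm]

theorem gradCMul_eq_adjoint {x : Vec n} (hc : DifferentiableAt ℝ P.c x) (mu : Vec p) :
    P.gradCMul x mu = ContinuousLinearMap.adjoint (fderiv ℝ P.c x) mu := by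
  refine ext_inner_right ℝ fun d => ?_
  rw [inner_gradCMul hc, ContinuousLinearMap.adjoint_inner_left]

theorem hasFDerivAt_lagr {x : Vec n} (hf : DifferentiableAt ℝ P.f x)
    (hc : DifferentiableAt ℝ P.c x) (mu : Vec p) :
    HasFDerivAt (P.lagr mu) (fderiv ℝ P.f x + (innerSL ℝ mu).comp (fderiv ℝ P.c x)) x :=
  hf.hasFDerivAt.add ((innerSL ℝ mu).hasFDerivAt.comp x hc.hasFDerivAt)

theorem inner_lagrGrad {x : Vec n} (hf : DifferentiableAt ℝ P.f x)
    (hc : DifferentiableAt ℝ P.c x) (mu : Vec p) (d : Vec n) :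
    inner ℝ (P.lagrGrad x mu) d = fderiv ℝ (P.lagr mu) x d := by
  rw [(hasFDerivAt_lagr hf hc mu).fderiv, lagrGrad, inner_add_left, inner_gradient_left,
    inner_gradCMul hc]
  rfl

namespace OverallRegularity

variable {xs : Vec n} {ys : Vec m} {mus : Vec p} {lams : Vec q}

theorem diff_f (h : P.OverallRegularity xs ys mus lams) : Differentiable ℝ P.f :=
  h.contDiff_f.differentiable one_ne_zero

theorem diff_c (h : P.OverallRegularity xs ys mus lams) : Differentiable ℝ P.c :=
  h.contDiff_c.differentiable one_ne_zero

theorem contDiffAt_fderiv_f (h : P.OverallRegularity xs ys mus lams) :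
    ContDiffAt ℝ 1 (fderiv ℝ P.f) xs := by
  obtain ⟨U, hU, hx, hf, -⟩ := h.twice
  exact (hf.contDiffAt (hU.mem_nhds hx)).fderiv_right (by norm_num)

theorem contDiffAt_fderiv_c (h : P.OverallRegularity xs ys mus lams) :
    ContDiffAt ℝ 1 (fderiv ℝ P.c) xs := by
  obtain ⟨U, hU, hx, -, hc⟩ := h.twice
  exact (hc.contDiffAt (hU.mem_nhds hx)).fderiv_right (by norm_num)

theorem differentiable_lagr (h : P.OverallRegularity xs ys mus lams) (mu : Vec p) :
    Differentiable ℝ (P.lagr mu) :=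
  fun x => (hasFDerivAt_lagr (h.diff_f x) (h.diff_c x) mu).differentiableAt

theorem fderiv_lagr_eq_sum (h : P.OverallRegularity xs ys mus lams) (mu : Vec p) :
    fderiv ℝ (P.lagr mu)
      = fun x => fderiv ℝ P.f x + ∑ j, mu j • fderiv ℝ (fun u => P.c u j) x := by
  funext x
  rw [(hasFDerivAt_lagr (h.diff_f x) (h.diff_c x) mu).fderiv]
  ext d
  simp [fderiv_c_apply (h.diff_c x), PiLp.inner_apply, mul_comm]

theorem hasFDerivAt_fderiv_lagr (h : P.OverallRegularity xs ys mus lams) (mu : Vec p) :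
    HasFDerivAt (fderiv ℝ (P.lagr mu)) (fderiv ℝ (fderiv ℝ P.f) xs
      + ∑ j, mu j • fderiv ℝ (fderiv ℝ (fun u => P.c u j)) xs) xs := by
  rw [h.fderiv_lagr_eq_sum mu]
  have hj : ∀ j : Fin p, DifferentiableAt ℝ (fderiv ℝ fun u => P.c u j) xs := fun j => by
    obtain ⟨U, hU, hx, -, hc⟩ := h.twice
    have h2 : ContDiffAt ℝ 2 (fun u => P.c u j) xs :=
      (EuclideanSpace.proj (𝕜 := ℝ) j).contDiff.contDiffAt.comp xs (hc.contDiffAt (hU.mem_nhds hx))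
    exact (h2.fderiv_right (m := 1) (by norm_num)).differentiableAt one_ne_zero
  exact (h.contDiffAt_fderiv_f.differentiableAt one_ne_zero).hasFDerivAt.add
    (HasFDerivAt.fun_sum fun j _ => (hj j).hasFDerivAt.fun_const_smul (mu j))

theorem quadratic_eq (h : P.OverallRegularity xs ys mus lams) (mu : Vec p) (d : Vec n) :
    d.ofLp ⬝ᵥ (P.lagrangianHessian xs mu).mulVec d.ofLp
      = fderiv ℝ (fderiv ℝ (P.lagr mu)) xs d d := by
  rw [(h.hasFDerivAt_fderiv_lagr mu).fderiv, lagrangianHessian, Matrix.add_mulVec,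
    dotProduct_add, dotProduct_hessian, Matrix.sum_mulVec, dotProduct_sum]
  simp only [Matrix.smul_mulVec, dotProduct_smul, dotProduct_hessian]
  simp

end OverallRegularity

end Problem

end ADMM

/-! ### Consequences of regularity: penalized curvature, multiplier bounds, local estimates -/

namespace ADMM

namespace Problem

variable {n m p q : ℕ} (P : Problem n m p q)

/-- The second derivative of the Lagrangian, as a quadratic form. -/
noncomputable def curvature (x : Vec n) (mu : Vec p) (d : Vec n) : ℝ :=
  fderiv ℝ (fderiv ℝ (P.lagr mu)) x d d

variable {P}

theorem constraintJacobian_mulVec {x : Vec n} (hc : DifferentiableAt ℝ P.c x) (d : Vec n)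
    (z : Vec m) :
    (P.constraintJacobian x).mulVec (Sum.elim d.ofLp z.ofLp)
      = Sum.elim (fderiv ℝ P.c x d).ofLp (mulV P.A d + mulV P.B z).ofLp := by
  rw [constraintJacobian, Matrix.fromBlocks_mulVec]
  congr 1
  ext j
  have h := gradC_inner hc j d
  rw [inner_eq_dotProduct] at h
  simp [← h, Matrix.mulVec, Matrix.of_apply]

theorem vecMul_constraintJacobian (x : Vec n) (mu : Vec p) (lam : Vec q) :
    Matrix.vecMul (Sum.elim mu.ofLp lam.ofLp) (P.constraintJacobian x)
      = Sum.elim (P.gradCMul x mu + mulV P.A.transpose lam).ofLp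
        (mulV P.B.transpose lam).ofLp := by
  rw [constraintJacobian, Matrix.vecMul_fromBlocks]
  congr 1
  · ext i
    simp [gradCMul, mulV, Matrix.mulVec_transpose, Matrix.vecMul, dotProduct]
  · ext i
    simp [mulV, Matrix.mulVec_transpose]

namespace OverallRegularity

variable {xs : Vec n} {ys : Vec m} {mus : Vec p} {lams : Vec q}

theorem curvature_pos (h : P.OverallRegularity xs ys mus lams) (d : Vec n) (z : Vec m)
    (hdz : (d, z) ≠ 0) (hd : fderiv ℝ P.c xs d = 0) (hz : mulV P.A d + mulV P.B z = 0) :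
    0 < P.curvature xs mus d := by
  have := h.sosc (Sum.elim d.ofLp z.ofLp) (by
    intro h0
    apply hdz
    ext i
    · simpa using congrFun h0 (Sum.inl i)
    · simpa using congrFun h0 (Sum.inr i)) (by
    rw [constraintJacobian_mulVec (h.diff_c xs), hd, hz]
    ext (i | i) <;> simp)
  rw [Matrix.fromBlocks_mulVec, sumElim_dotProduct_sumElim] at this
  simpa [curvature, h.quadratic_eq] using this

/-- The second order condition with the constraints replaced by quadratic penalties. -/
theorem exists_penalty (h : P.OverallRegularity xs ys mus lams) :
    ∃ σ α : ℝ, 0 < σ ∧ 0 < α ∧ ∀ (d : Vec n) (z : Vec m), α * ‖d‖ ^ 2 ≤ P.curvature xs mus d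
      + σ * (‖fderiv ℝ P.c xs d‖ ^ 2 + ‖mulV P.A d + mulV P.B z‖ ^ 2) := by
  obtain ⟨σ, α, hσ, hα, hle⟩ := exists_penalty_of_pos_on_zeros (E := Vec n × Vec m)
    (Q := fun w => P.curvature xs mus w.1)
    (T := fun w => ‖fderiv ℝ P.c xs w.1‖ ^ 2 + ‖mulV P.A w.1 + mulV P.B w.2‖ ^ 2)
    (by unfold curvature; fun_prop) (by fun_prop)
    (fun t w => by simp [curvature]; ring)
    (fun t w => by
      simp only [Prod.smul_fst, Prod.smul_snd, map_smul, mulV_smul, ← smul_add, norm_smul, mul_pow,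
        Real.norm_eq_abs, sq_abs]
      ring)
    (fun w => by positivity)
    (fun w hw hT => by
      have h1 : ‖fderiv ℝ P.c xs w.1‖ ^ 2 = 0 := by
        nlinarith [sq_nonneg ‖fderiv ℝ P.c xs w.1‖, sq_nonneg ‖mulV P.A w.1 + mulV P.B w.2‖]
      have h2 : ‖mulV P.A w.1 + mulV P.B w.2‖ ^ 2 = 0 := by
        nlinarith [sq_nonneg ‖fderiv ℝ P.c xs w.1‖, sq_nonneg ‖mulV P.A w.1 + mulV P.B w.2‖]
      exact h.curvature_pos w.1 w.2 hw (by simpa using h1) (by simpa using h2))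
  refine ⟨σ, α, hσ, hα, fun d z => le_trans ?_ (hle (d, z))⟩
  have : ‖d‖ ≤ ‖(d, z)‖ := norm_fst_le (d, z)
  gcongr

/-- Multipliers are controlled by the residual of the stationarity condition. -/
theorem exists_multiplier_bound (h : P.OverallRegularity xs ys mus lams) :
    ∃ K : ℝ, 0 < K ∧ ∀ (mu : Vec p) (lam : Vec q), mulV P.B.transpose lam = 0 →
      ‖mu‖ ≤ K * ‖P.gradCMul xs mu + mulV P.A.transpose lam‖ ∧
      ‖lam‖ ≤ K * ‖P.gradCMul xs mu + mulV P.A.transpose lam‖ := by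
  let W : Vec p × Vec q →L[ℝ] Vec n × Vec m :=
    ((ContinuousLinearMap.adjoint (fderiv ℝ P.c xs)).comp (ContinuousLinearMap.fst ℝ _ _)
      + (mulL P.A.transpose).comp (ContinuousLinearMap.snd ℝ _ _)).prod
    ((mulL P.B.transpose).comp (ContinuousLinearMap.snd ℝ _ _))
  have hW : ∀ mu lam, W (mu, lam)
      = (P.gradCMul xs mu + mulV P.A.transpose lam, mulV P.B.transpose lam) := fun mu lam => by
    rw [gradCMul_eq_adjoint (h.diff_c xs)]
    rfl
  -- `W` is the transpose of the constraint Jacobian, so independent rows make it injective, hence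
  -- bounded below in finite dimension.
  have hker : LinearMap.ker W.toLinearMap = ⊥ := by
    rw [LinearMap.ker_eq_bot']
    rintro ⟨mu, lam⟩ h0
    have h0' : W (mu, lam) = 0 := h0
    rw [hW, Prod.mk_eq_zero] at h0'
    have hinj := Matrix.vecMul_injective_iff.2 h.licq
    have h1 : Sum.elim mu.ofLp lam.ofLp = 0 := hinj (by
      simp only
      rw [vecMul_constraintJacobian, h0'.1, h0'.2, Matrix.zero_vecMul]
      ext (i | i) <;> simp)
    ext i
    · simpa using congrFun h1 (Sum.inl i)
    · simpa using congrFun h1 (Sum.inr i)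
  obtain ⟨K, hK, hanti⟩ := W.toLinearMap.exists_antilipschitzWith hker
  refine ⟨K, by exact_mod_cast hK, fun mu lam hB => ?_⟩
  have h1 : ‖(mu, lam)‖ ≤ K * ‖W (mu, lam)‖ :=
    ZeroHomClass.bound_of_antilipschitz W.toLinearMap hanti (mu, lam)
  rw [hW, hB, Prod.norm_mk (P.gradCMul xs mu + mulV P.A.transpose lam), norm_zero,
    max_eq_left (norm_nonneg _)] at h1
  exact ⟨(norm_fst_le (mu, lam)).trans h1, (norm_snd_le (mu, lam)).trans h1⟩

/-- A local monotonicity estimate in which `μ` varies too. The change in `x` at fixed `μ*` produces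
the curvature; the change in `μ` contributes `⟨μ - μ*, c'(x)(x - x*)⟩`, which is a small factor
times a quadratic term on the feasible set. -/
theorem eventually_inner_lagrGrad_ge (h : P.OverallRegularity xs ys mus lams) {ε : ℝ}
    (hε : 0 < ε) :
    ∀ᶠ w : Vec n × Vec p in 𝓝 (xs, mus), P.c w.1 = 0 →
      P.curvature xs mus (w.1 - xs) - ε * ‖w.1 - xs‖ ^ 2
        ≤ inner ℝ (P.lagrGrad w.1 w.2 - P.lagrGrad xs mus) (w.1 - xs) := by
  obtain ⟨M, hM, hlin⟩ := exists_linearization_bound h.diff_c h.contDiffAt_fderiv_c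
  have h1 := (h.hasFDerivAt_fderiv_lagr mus).differentiableAt.hasFDerivAt.isLittleO.def
    (half_pos hε)
  rw [nhds_prod_eq]
  have h2 : ∀ᶠ mu in 𝓝 mus, ‖mu - mus‖ * M ≤ ε / 2 := by
    have : Tendsto (fun mu => ‖mu - mus‖ * M) (𝓝 mus) (𝓝 (‖mus - mus‖ * M)) :=
      Continuous.tendsto (by fun_prop) mus
    rw [sub_self, norm_zero, zero_mul] at this
    exact this.eventually_le_const (half_pos hε)
  filter_upwards [(hlin.and h1).prod_mk h2]
  rintro ⟨x, mu⟩ ⟨⟨hx1, hx2⟩, hmu⟩ hcx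
  simp only at hx1 hx2 hmu hcx ⊢
  -- Linearizing at `x`, with `c` zero at both points, makes `c'(x)(x - x*)` itself the
  -- linearization error, of size at most `M‖x - x*‖²`.
  rw [hcx, h.kkt.feas_c, sub_zero, zero_sub, ← map_neg, neg_sub] at hx1
  have hsplit : P.lagrGrad x mu - P.lagrGrad xs mus
      = (P.lagrGrad x mus - P.lagrGrad xs mus) + P.gradCMul x (mu - mus) := by
    simp only [lagrGrad, gradCMul_eq_adjoint (h.diff_c x), map_sub]
    abel
  set d := x - xs
  rw [hsplit, inner_add_left, inner_sub_left, inner_lagrGrad (h.diff_f x) (h.diff_c x),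
    inner_lagrGrad (h.diff_f xs) (h.diff_c xs), inner_gradCMul (h.diff_c x)]
  have h3 := (fderiv ℝ (P.lagr mus) x - fderiv ℝ (P.lagr mus) xs
    - fderiv ℝ (fderiv ℝ (P.lagr mus)) xs d).le_opNorm d
  have h4 : ‖fderiv ℝ (P.lagr mus) x - fderiv ℝ (P.lagr mus) xs
    - fderiv ℝ (fderiv ℝ (P.lagr mus)) xs d‖ * ‖d‖ ≤ ε / 2 * ‖d‖ * ‖d‖ := by gcongr
  have h5 := (abs_le.1 (h3.trans h4)).1
  have h6 := (abs_le.1 (abs_real_inner_le_norm (mu - mus) (fderiv ℝ P.c x d))).1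
  have h7 : ‖mu - mus‖ * ‖fderiv ℝ P.c x d‖ ≤ ε / 2 * ‖d‖ ^ 2 :=
    calc _ ≤ ‖mu - mus‖ * (M * ‖d‖ ^ 2) := by gcongr
      _ = ‖mu - mus‖ * M * ‖d‖ ^ 2 := by ring
      _ ≤ _ := by gcongr
  simp only [sub_apply] at h5
  unfold curvature
  nlinarith

/-- Feasible displacements are tangent to first order, so the nonlinear part of the penalty can be
absorbed in `α‖d‖²`. -/
theorem eventually_jacobian_sq_le (h : P.OverallRegularity xs ys mus lams) {σ ε : ℝ}
    (hσ : 0 < σ) (hε : 0 < ε) :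
    ∀ᶠ x in 𝓝 xs, P.c x = 0 →
      σ * ‖fderiv ℝ P.c xs (x - xs)‖ ^ 2 ≤ ε * ‖x - xs‖ ^ 2 := by
  have hpos : 0 < Real.sqrt (ε / σ) := Real.sqrt_pos.2 (by positivity)
  filter_upwards [(h.diff_c xs).hasFDerivAt.isLittleO.def hpos] with x hx hcx
  rw [hcx, h.kkt.feas_c, sub_zero, zero_sub, norm_neg] at hx
  calc _ ≤ σ * (Real.sqrt (ε / σ) * ‖x - xs‖) ^ 2 := by gcongr
    _ = _ := by
      rw [mul_pow, Real.sq_sqrt (by positivity)]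
      field_simp

theorem eventually_lagr_ge (h : P.OverallRegularity xs ys mus lams) {ε : ℝ} (hε : 0 < ε) :
    ∀ᶠ x in 𝓝 xs, 1 / 2 * P.curvature xs mus (x - xs) - ε * ‖x - xs‖ ^ 2
      ≤ P.lagr mus x - P.lagr mus xs - fderiv ℝ (P.lagr mus) xs (x - xs) := by
  filter_upwards [taylor_two_isLittleO (h.differentiable_lagr mus)
    (h.hasFDerivAt_fderiv_lagr mus).differentiableAt hε] with x hx
  have := (abs_le.1 hx).1
  unfold curvature
  linarith

end OverallRegularity

end Problem

end ADMM

/-! ### Solvability of the perturbed subproblem near the solution -/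

namespace ADMM

namespace Problem

variable {n m p q : ℕ} {P : Problem n m p q}

theorem residual_eq {xs : Vec n} {ys : Vec m} (hfeas : mulV P.A xs + mulV P.B ys = P.b)
    (x : Vec n) (y : Vec m) :
    P.residual x y = mulV P.A (x - xs) + mulV P.B (y - ys) := by
  rw [residual, ← hfeas, mulV_sub, mulV_sub]
  abel

/-- The gradient of the subproblem objective. -/
noncomputable def spGrad (P : Problem n m p q) (ρ : ℝ) (y : Vec m) (lam : Vec q) (x : Vec n) :
    Vec n :=
  gradient P.f x + mulV P.A.transpose (lam + ρ • P.residual x y)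

theorem isSPKKT_iff {ρ : ℝ} {y : Vec m} {lam : Vec q} {x : Vec n} {mu : Vec p} :
    P.IsSPKKT ρ y lam x mu ↔ P.gradCMul x mu + P.spGrad ρ y lam x = 0 ∧ P.c x = 0 := by
  have : P.gradCMul x mu + P.spGrad ρ y lam x = gradient P.f x + P.gradCMul x mu
    + mulV P.A.transpose (lam + ρ • P.residual x y) := by
    rw [spGrad]
    abel
  rw [this]
  exact ⟨fun h => ⟨h.1, h.2⟩, fun h => ⟨h.1, h.2⟩⟩

theorem hasStrictFDerivAt_spObj {ρ : ℝ} {y : Vec m} {lam : Vec q} {x : Vec n}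
    (hf : ContDiff ℝ 1 P.f) :
    HasStrictFDerivAt (P.spObj ρ y lam) (innerSL ℝ (P.spGrad ρ y lam x)) x := by
  have h1 : HasStrictFDerivAt P.f (fderiv ℝ P.f x) x :=
    hf.contDiffAt.hasStrictFDerivAt one_ne_zero
  have h2 : HasStrictFDerivAt (fun x => P.residual x y) (mulL P.A) x := by
    simpa [residual] using! ((mulL P.A).hasStrictFDerivAt (x := x)).add_const (mulV P.B y)
      |>.sub_const P.b
  have h3 := ((innerSL ℝ lam).hasStrictFDerivAt.comp x h2)
  have h4 := ((hasStrictFDerivAt_norm_sq (P.residual x y)).comp x h2).const_mul (ρ / 2)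
  refine (h1.add (h3.add h4)).congr_fderiv ?_
  ext d
  simp only [spGrad, add_apply, ContinuousLinearMap.comp_apply, innerSL_apply_apply, smul_apply,
    inner_add_left, inner_gradient_left, inner_mulV_transpose, inner_smul_left, mulL_apply,
    smul_eq_mul, nsmul_eq_mul]
  simp
  ring

/-- The Lagrange rule first gives a multiplier with a factor `t` on the objective; injectivity of
the transposed Jacobian excludes `t = 0`, and one divides by `t`. -/
theorem IsSPLocalMin.exists_multiplier {ρ : ℝ} {y : Vec m} {lam : Vec q} {x : Vec n}
    (hmin : P.IsSPLocalMin ρ y lam x) (hf : ContDiff ℝ 1 P.f) (hc : ContDiff ℝ 1 P.c)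
    (hinj : ∀ mu, P.gradCMul x mu = 0 → mu = 0) : ∃ mu, P.IsSPKKT ρ y lam x mu := by
  have hcx : P.c x = 0 := hmin.1
  have hset : P.spFeasible = {u | P.c u = P.c x} := by
    rw [hcx]
    rfl
  have hloc : IsLocalExtrOn (P.spObj ρ y lam) {u | P.c u = P.c x} x := by
    rw [← hset]
    exact Or.inl hmin.2
  obtain ⟨L, t, hne, hsum⟩ := hloc.exists_linear_map_of_hasStrictFDerivAt
    (hc.contDiffAt.hasStrictFDerivAt one_ne_zero) (hasStrictFDerivAt_spObj hf)
  let nu : Vec p := (InnerProductSpace.toDual ℝ (Vec p)).symm (LinearMap.toContinuousLinearMap L)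
  have hnu : ∀ z, inner ℝ nu z = L z := fun z => by
    simp [nu, InnerProductSpace.toDual_symm_apply]
  have hstat : P.gradCMul x nu + t • P.spGrad ρ y lam x = 0 := by
    refine ext_inner_right ℝ fun d => ?_
    rw [inner_add_left, inner_gradCMul (hc.differentiable one_ne_zero x), hnu, inner_zero_left,
      inner_smul_left]
    simpa using hsum d
  have ht : t ≠ 0 := by
    rintro rfl
    have h0 : nu = 0 := hinj nu (by simpa using hstat)
    refine hne (Prod.ext (LinearMap.ext fun z => ?_) rfl)
    rw [← hnu, h0, inner_zero_left]
    rfl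
  refine ⟨t⁻¹ • nu, isSPKKT_iff.2 ⟨?_, hcx⟩⟩
  have := congrArg (t⁻¹ • ·) hstat
  simp only [smul_add, smul_smul, inv_mul_cancel₀ ht, one_smul, smul_zero] at this
  rw [← this, gradCMul_eq_adjoint (hc.differentiable one_ne_zero x), map_smul,
    gradCMul_eq_adjoint (hc.differentiable one_ne_zero x)]

namespace OverallRegularity

variable {xs : Vec n} {ys : Vec m} {mus : Vec p} {lams : Vec q}

theorem continuous_gradient (h : P.OverallRegularity xs ys mus lams) :
    Continuous (gradient P.f) :=
  (InnerProductSpace.toDual ℝ (Vec n)).symm.continuous.comp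
    (h.contDiff_f.continuous_fderiv one_ne_zero)

theorem continuous_spObj (h : P.OverallRegularity xs ys mus lams) (ρ : ℝ) :
    Continuous fun w : (Vec m × Vec q) × Vec n => P.spObj ρ w.1.1 w.1.2 w.2 := by
  have := h.diff_f.continuous
  unfold spObj augTerm residual
  fun_prop

theorem continuous_spGrad (h : P.OverallRegularity xs ys mus lams) (ρ : ℝ) :
    Continuous fun w : (Vec m × Vec q) × Vec n => P.spGrad ρ w.1.1 w.1.2 w.2 := by
  have := h.continuous_gradient
  unfold spGrad residual
  fun_prop

/-- At `(y*, λ*)` the subproblem objective is an augmented Lagrangian in `x`: its linear terms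
cancel by stationarity, and the penalized curvature inequality with `z = 0` makes the quadratic part
at least a multiple of `‖x - x*‖²`. -/
theorem spObj_growth (h : P.OverallRegularity xs ys mus lams) {σ α ρ : ℝ} (hσ : 0 < σ)
    (hα : 0 < α) (hpen : ∀ (d : Vec n) (z : Vec m), α * ‖d‖ ^ 2 ≤ P.curvature xs mus d
      + σ * (‖fderiv ℝ P.c xs d‖ ^ 2 + ‖mulV P.A d + mulV P.B z‖ ^ 2)) (hρ : σ ≤ ρ) :
    ∀ᶠ x in 𝓝 xs, P.c x = 0 → x ≠ xs → P.spObj ρ ys lams xs < P.spObj ρ ys lams x := by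
  filter_upwards [h.eventually_lagr_ge (show 0 < α / 8 by positivity),
    h.eventually_jacobian_sq_le hσ (show 0 < α / 4 by positivity)] with x hx1 hx2 hcx hne
  have hd : 0 < ‖x - xs‖ ^ 2 := by
    have := sub_ne_zero.2 hne
    positivity
  have h1 := hpen (x - xs) 0
  have h2 := hx2 hcx
  rw [mulV_zero, add_zero] at h1
  have hgrad : fderiv ℝ (P.lagr mus) xs (x - xs) = - inner ℝ lams (mulV P.A (x - xs)) := by
    rw [← inner_lagrGrad (h.diff_f xs) (h.diff_c xs), ← inner_mulV_transpose,
      ← inner_neg_left]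
    congr 1
    rw [lagrGrad]
    exact eq_neg_of_add_eq_zero_left h.kkt.stat_x
  rw [hgrad] at hx1
  have hs : P.spObj ρ ys lams xs = P.lagr mus xs := by
    simp [spObj, augTerm, residual_eq h.kkt.feas_lin, lagr, h.kkt.feas_c, mulV_zero]
  have hx : P.spObj ρ ys lams x = P.lagr mus x
      + (inner ℝ lams (mulV P.A (x - xs)) + ρ / 2 * ‖mulV P.A (x - xs)‖ ^ 2) := by
    simp [spObj, augTerm, residual_eq h.kkt.feas_lin, lagr, hcx, mulV_zero]
  have h3 := mul_le_mul_of_nonneg_right hρ (sq_nonneg ‖mulV P.A (x - xs)‖)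
  rw [hs, hx]
  nlinarith

/-- Strict growth separates the value at `x*` from the values on the feasible part of a small
sphere. Compactness preserves this separation under small changes of `(y, λ)`, so a minimizer over
the closed ball lies in its interior and is a local minimum. -/
theorem eventually_exists_localMin (h : P.OverallRegularity xs ys mus lams) {ρ : ℝ}
    (hgrow : ∀ᶠ x in 𝓝 xs, P.c x = 0 → x ≠ xs → P.spObj ρ ys lams xs < P.spObj ρ ys lams x)
    {r : ℝ} (hr : 0 < r) :
    ∀ᶠ w : Vec m × Vec q in 𝓝 (ys, lams),
      ∃ x, ‖x - xs‖ < r ∧ P.IsSPLocalMin ρ w.1 w.2 x := by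
  obtain ⟨s, hs, hball⟩ := Metric.eventually_nhds_iff_ball.1 hgrow
  obtain ⟨δ, hδ, hδrs⟩ := exists_between (lt_min hr hs)
  obtain ⟨hδr, hδs⟩ := lt_min_iff.1 hδrs
  have hclosed : IsClosed P.spFeasible := isClosed_eq h.diff_c.continuous continuous_const
  have hcont := h.continuous_spObj ρ
  have htube := ((isCompact_sphere xs δ).inter_right
      hclosed).eventually_forall_of_forall_eventually (x₀ := (ys, lams))
    (P := fun w x => P.spObj ρ w.1 w.2 xs < P.spObj ρ w.1 w.2 x) (by
      rintro x ⟨hx, hcx⟩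
      have hx' : ‖x - xs‖ = δ := by simpa [dist_eq_norm] using hx
      have hlt : P.spObj ρ ys lams xs < P.spObj ρ ys lams x :=
        hball x (by rw [mem_ball_iff_norm, hx']; exact hδs) hcx (by
          rintro rfl
          rw [sub_self, norm_zero] at hx'
          exact hδ.ne hx')
      have hc1 : Continuous fun z : (Vec m × Vec q) × Vec n => P.spObj ρ z.1.1 z.1.2 xs :=
        hcont.comp (continuous_fst.prodMk continuous_const)
      exact (isOpen_lt hc1 hcont).mem_nhds hlt)
  filter_upwards [htube] with w hw
  have hxsmem : xs ∈ Metric.closedBall xs δ ∩ P.spFeasible :=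
    ⟨Metric.mem_closedBall_self hδ.le, h.kkt.feas_c⟩
  obtain ⟨x, ⟨hxb, hxf⟩, hxmin⟩ := ((isCompact_closedBall xs δ).inter_right
    hclosed).exists_isMinOn ⟨xs, hxsmem⟩
    (f := P.spObj ρ w.1 w.2) (hcont.comp (continuous_const.prodMk continuous_id)).continuousOn
  have hlt : ‖x - xs‖ < δ := by
    rw [mem_closedBall_iff_norm] at hxb
    refine lt_of_le_of_ne hxb fun heq => ?_
    have h1 := hw x ⟨by simpa [dist_eq_norm] using heq, hxf⟩
    exact absurd (hxmin hxsmem) (not_le.2 h1)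
  refine ⟨x, hlt.trans hδr, hxf, ?_⟩
  have hnhds : Metric.ball xs δ ∈ 𝓝 x := Metric.isOpen_ball.mem_nhds (mem_ball_iff_norm.2 hlt)
  filter_upwards [mem_nhdsWithin_of_mem_nhds hnhds, self_mem_nhdsWithin] with u hu1 hu2
  exact hxmin ⟨Metric.ball_subset_closedBall hu1, hu2⟩

/-- The multiplier bound at `x*` survives a small change of the Jacobian. This gives both existence
of a multiplier at a nearby local minimum and its closeness to `μ*`. -/
theorem eventually_exists_multiplier (h : P.OverallRegularity xs ys mus lams) (ρ : ℝ) {δ : ℝ}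
    (hδ : 0 < δ) :
    ∀ᶠ w : (Vec m × Vec q) × Vec n in 𝓝 ((ys, lams), xs),
      P.IsSPLocalMin ρ w.1.1 w.1.2 w.2 →
        ∃ mu, P.IsSPKKT ρ w.1.1 w.1.2 w.2 mu ∧ ‖mu - mus‖ < δ := by
  obtain ⟨K, hK, hbound⟩ := h.exists_multiplier_bound
  let θ : Vec n → ℝ := fun x =>
    ‖ContinuousLinearMap.adjoint (fderiv ℝ P.c x) - ContinuousLinearMap.adjoint (fderiv ℝ P.c xs)‖
  have hθ : Continuous θ := by
    have h1 : Continuous fun x => ContinuousLinearMap.adjoint (fderiv ℝ P.c x) :=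
      ContinuousLinearMap.adjoint.continuous.comp (h.contDiff_c.continuous_fderiv one_ne_zero)
    fun_prop
  have hg := h.continuous_spGrad ρ
  let ψ : (Vec m × Vec q) × Vec n → ℝ := fun w =>
    -- The factor `2` comes from `K θ < 1/2`, which lets the term `K θ ‖μ - μ*‖` be absorbed on the
    -- left of the final bound.
    2 * K * (θ w.2 * ‖mus‖ + ‖P.spGrad ρ w.1.1 w.1.2 w.2 - P.spGrad ρ ys lams xs‖)
  have hψ : Continuous ψ := by fun_prop
  have hθ0 : θ xs = 0 := by simp [θ]
  have ev1 : ∀ᶠ w : (Vec m × Vec q) × Vec n in 𝓝 ((ys, lams), xs), K * θ w.2 < 1 / 2 := by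
    have hc : Continuous fun w : (Vec m × Vec q) × Vec n => K * θ w.2 := by fun_prop
    exact (hc.tendsto ((ys, lams), xs)).eventually_lt_const (by simp [hθ0])
  have ev2 : ∀ᶠ w in 𝓝 ((ys, lams), xs), ψ w < δ :=
    (hψ.tendsto ((ys, lams), xs)).eventually_lt_const (by simpa [ψ, hθ0] using hδ)
  filter_upwards [ev1, ev2]
  rintro ⟨⟨y, lam⟩, x⟩ hx1 hx2 hmin
  simp only [ψ] at hx1 hx2 hmin ⊢
  have hdiff : ∀ mu, ‖P.gradCMul xs mu - P.gradCMul x mu‖ ≤ θ x * ‖mu‖ := fun mu => by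
    rw [norm_sub_rev, gradCMul_eq_adjoint (h.diff_c xs), gradCMul_eq_adjoint (h.diff_c x),
      ← sub_apply]
    exact ContinuousLinearMap.le_opNorm _ _
  have hbound' : ∀ mu, ‖mu‖ ≤ K * ‖P.gradCMul xs mu‖ := fun mu => by
    simpa [mulV_zero] using (hbound mu 0 (mulV_zero _)).1
  obtain ⟨mu, hmu⟩ := hmin.exists_multiplier h.contDiff_f h.contDiff_c (fun mu h0 => by
    have h1 := hdiff mu
    rw [h0, sub_zero] at h1
    have h2 := (hbound' mu).trans (mul_le_mul_of_nonneg_left h1 hK.le)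
    by_contra hne
    have h3 : 0 < ‖mu‖ := norm_pos_iff.2 hne
    nlinarith)
  refine ⟨mu, hmu, ?_⟩
  have hs : P.gradCMul xs mus + P.spGrad ρ ys lams xs = 0 := by
    rw [spGrad, residual_eq h.kkt.feas_lin, sub_self, sub_self, mulV_zero, mulV_zero, add_zero,
      smul_zero, add_zero, ← h.kkt.stat_x]
    abel
  have h1 := (isSPKKT_iff.1 hmu).1
  have hsplit : P.gradCMul xs (mu - mus) = (P.gradCMul xs mu - P.gradCMul x mu)
      - (P.spGrad ρ y lam x - P.spGrad ρ ys lams xs) := by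
    rw [eq_neg_of_add_eq_zero_left h1, gradCMul_eq_adjoint (h.diff_c xs), map_sub,
      ← gradCMul_eq_adjoint (h.diff_c xs), ← gradCMul_eq_adjoint (h.diff_c xs),
      eq_neg_of_add_eq_zero_left hs]
    abel
  have h2 : ‖mu - mus‖ ≤ K * (θ x * (‖mu - mus‖ + ‖mus‖)
      + ‖P.spGrad ρ y lam x - P.spGrad ρ ys lams xs‖) := by
    refine (hbound' _).trans (mul_le_mul_of_nonneg_left ?_ hK.le)
    rw [hsplit]
    refine (norm_sub_le _ _).trans (add_le_add_left ((hdiff mu).trans ?_) _)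
    refine mul_le_mul_of_nonneg_left ?_ (norm_nonneg _)
    simpa using norm_add_le (mu - mus) mus
  nlinarith [norm_nonneg (mu - mus)]

/-- Solutions of the perturbed subproblem exist near the solution of the problem. -/
theorem eventually_exists_minMultiplier (h : P.OverallRegularity xs ys mus lams) {ρ : ℝ}
    (hgrow : ∀ᶠ x in 𝓝 xs, P.c x = 0 → x ≠ xs → P.spObj ρ ys lams xs < P.spObj ρ ys lams x)
    {δ : ℝ} (hδ : 0 < δ) :
    ∀ᶠ w : Vec m × Vec q in 𝓝 (ys, lams), ∃ x mu,
      P.IsSPMinMultiplier ρ w.1 w.2 x mu ∧ ‖x - xs‖ < δ ∧ ‖mu - mus‖ < δ := by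
  have h1 := h.eventually_exists_multiplier ρ hδ
  rw [nhds_prod_eq, eventually_prod_iff] at h1
  obtain ⟨pw, hpw, px, hpx, hprod⟩ := h1
  obtain ⟨r, hr, hball⟩ := Metric.eventually_nhds_iff_ball.1 hpx
  filter_upwards [hpw, h.eventually_exists_localMin hgrow (lt_min hr hδ)] with w hw hmin
  obtain ⟨x, hx, hxmin⟩ := hmin
  obtain ⟨hxr, hxδ⟩ := lt_min_iff.1 hx
  obtain ⟨mu, hmu, hmuδ⟩ := hprod hw (hball x (mem_ball_iff_norm.2 hxr)) hxmin
  exact ⟨x, mu, ⟨hxmin, hmu⟩, hxδ, hmuδ⟩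

end OverallRegularity

end Problem

end ADMM

/-! ### The weighted norm and the one-step descent inequality -/

namespace ADMM

namespace Problem

variable {n m p q : ℕ} {P : Problem n m p q}

theorem rhoNorm_nonneg (ρ : ℝ) (y : Vec m) (lam : Vec q) : 0 ≤ P.rhoNorm ρ y lam :=
  Real.sqrt_nonneg _

theorem rhoNorm_sq {ρ : ℝ} (hρ : 0 < ρ) (y : Vec m) (lam : Vec q) :
    P.rhoNorm ρ y lam ^ 2 = ρ * ‖mulV P.B y‖ ^ 2 + 1 / ρ * ‖lam‖ ^ 2 :=
  Real.sq_sqrt (by positivity)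

theorem sqrt_mul_norm_le_rhoNorm {ρ : ℝ} (hρ : 0 < ρ) (y : Vec m) (lam : Vec q) :
    Real.sqrt ρ * ‖mulV P.B y‖ ≤ P.rhoNorm ρ y lam := by
  refine le_of_sq_le_sq ?_ (rhoNorm_nonneg ρ y lam)
  rw [rhoNorm_sq hρ, mul_pow, Real.sq_sqrt hρ.le]
  have : 0 ≤ 1 / ρ * ‖lam‖ ^ 2 := by positivity
  linarith

theorem norm_le_sqrt_mul_rhoNorm {ρ : ℝ} (hρ : 0 < ρ) (y : Vec m) (lam : Vec q) :
    ‖lam‖ ≤ Real.sqrt ρ * P.rhoNorm ρ y lam := by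
  refine le_of_sq_le_sq ?_ (mul_nonneg (Real.sqrt_nonneg _) (rhoNorm_nonneg ρ y lam))
  rw [mul_pow, rhoNorm_sq hρ, Real.sq_sqrt hρ.le]
  have h1 : ρ * (ρ * ‖mulV P.B y‖ ^ 2 + 1 / ρ * ‖lam‖ ^ 2)
      = ρ * (ρ * ‖mulV P.B y‖ ^ 2) + ‖lam‖ ^ 2 := by
    field_simp
  have h2 : 0 ≤ ρ * (ρ * ‖mulV P.B y‖ ^ 2) := by positivity
  linarith

theorem eventually_rhoNorm_lt (ρ : ℝ) (ys : Vec m) (lams : Vec q) {R : ℝ} (hR : 0 < R) :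
    ∀ᶠ w : Vec m × Vec q in 𝓝 (ys, lams), P.rhoNorm ρ (w.1 - ys) (w.2 - lams) < R := by
  have hc : Continuous fun w : Vec m × Vec q => P.rhoNorm ρ (w.1 - ys) (w.2 - lams) := by
    unfold rhoNorm
    fun_prop
  exact (hc.tendsto (ys, lams)).eventually_lt_const (by simpa [rhoNorm, mulV_zero] using hR)

theorem transpose_mulV_eq_zero_of_isMinOn {ρ : ℝ} {lam : Vec q} {x : Vec n} {y : Vec m}
    (hmin : IsMinOn (fun v => P.augTerm ρ lam x v) Set.univ y) :
    mulV P.B.transpose (lam + ρ • P.residual x y) = 0 := by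
  have h2 : HasFDerivAt (fun v => P.residual x v) (mulL P.B) y := by
    simpa [residual] using! ((mulL P.B).hasFDerivAt (x := y)).const_add (mulV P.A x)
      |>.sub_const P.b
  have h3 := ((innerSL ℝ lam).hasFDerivAt.comp y h2)
  have h4 := ((hasStrictFDerivAt_norm_sq (P.residual x y)).hasFDerivAt.comp y h2).const_mul (ρ / 2)
  have h5 : HasFDerivAt (fun v => P.augTerm ρ lam x v) _ y := h3.add h4
  have h6 := (hmin.isLocalMin univ_mem).hasFDerivAt_eq_zero h5
  refine ext_inner_right ℝ fun d => ?_
  have h7 := congrArg (fun T => T d) h6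
  simp only [add_apply, ContinuousLinearMap.comp_apply, innerSL_apply_apply, smul_apply,
    mulL_apply, smul_eq_mul, nsmul_eq_mul, zero_apply] at h7
  rw [inner_mulV_transpose, inner_add_left, inner_smul_left, inner_zero_left, ← h7]
  simp
  ring

theorem IsADMM.transpose_mulV_eq_zero {ρ : ℝ} {x : ℕ → Vec n} {y : ℕ → Vec m} {lam : ℕ → Vec q}
    (h : P.IsADMM ρ x y lam) (k : ℕ) : mulV P.B.transpose (lam k) = 0 := by
  cases k with
  | zero => exact h.init
  | succ k =>
    rw [h.lam_step k]
    exact transpose_mulV_eq_zero_of_isMinOn (h.y_step k)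

/-- An accepted step satisfies the perturbed stationarity condition at the new multiplier. -/
theorem IsSPKKT.stat_next {ρ : ℝ} {xs : Vec n} {ys y y' : Vec m} {lam lam' : Vec q} {x : Vec n}
    {mu : Vec p} (hfeas : mulV P.A xs + mulV P.B ys = P.b) (hk : P.IsSPKKT ρ y lam x mu)
    (hlam : lam' = lam + ρ • P.residual x y') :
    P.lagrGrad x mu + mulV P.A.transpose (lam' - ρ • mulV P.B (y' - y)) = 0 := by
  rw [← hk.stat, lagrGrad, hlam, residual_eq hfeas, residual_eq hfeas]
  congr 2
  have : y' - y = (y' - ys) - (y - ys) := by abel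
  rw [this, mulV_sub P.B (y' - ys)]
  module

namespace OverallRegularity

variable {xs : Vec n} {ys : Vec m} {mus : Vec p} {lams : Vec q}

/-- Multiplication by `B` is bounded below. -/
theorem exists_norm_le_mulV_B (h : P.OverallRegularity xs ys mus lams) :
    ∃ K : ℝ, 0 < K ∧ ∀ z : Vec m, ‖z‖ ≤ K * ‖mulV P.B z‖ := by
  have hker : LinearMap.ker (mulL P.B).toLinearMap = ⊥ := by
    rw [LinearMap.ker_eq_bot']
    intro z hz
    by_contra hne
    have hz' : mulV P.B z = 0 := hz
    -- A nonzero `z` with `Bz = 0` would give the critical direction `(0, z)`, whose curvature is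
    -- zero.
    have := h.curvature_pos 0 z (by simpa using hne) (by simp) (by rw [mulV_zero, hz', add_zero])
    simp [curvature] at this
  obtain ⟨K, hK, hanti⟩ := (mulL P.B).toLinearMap.exists_antilipschitzWith hker
  exact ⟨K, by exact_mod_cast hK, fun z =>
    ZeroHomClass.bound_of_antilipschitz (mulL P.B).toLinearMap hanti z⟩

/-- The error decreases along a step whose new iterate is near the solution. -/
theorem eventually_descent (h : P.OverallRegularity xs ys mus lams) {σ α ρ : ℝ} (hσ : 0 < σ)
    (hα : 0 < α) (hpen : ∀ (d : Vec n) (z : Vec m), α * ‖d‖ ^ 2 ≤ P.curvature xs mus d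
      + σ * (‖fderiv ℝ P.c xs d‖ ^ 2 + ‖mulV P.A d + mulV P.B z‖ ^ 2)) (hρ : 0 < ρ) :
    ∀ᶠ w : Vec n × Vec p in 𝓝 (xs, mus), ∀ (y y' : Vec m) (lam lam' : Vec q),
      P.IsSPKKT ρ y lam w.1 w.2 → mulV P.B.transpose lam = 0 → mulV P.B.transpose lam' = 0 →
      lam' = lam + ρ • P.residual w.1 y' →
      P.rhoNorm ρ (y' - ys) (lam' - lams) ^ 2 + (α * ‖w.1 - xs‖ ^ 2 + ρ * ‖mulV P.B (y' - y)‖ ^ 2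
        + (1 / ρ - 2 * σ * (1 / ρ) ^ 2) * ‖lam' - lam‖ ^ 2)
      ≤ P.rhoNorm ρ (y - ys) (lam - lams) ^ 2 := by
  have ev := h.eventually_jacobian_sq_le hσ (show 0 < α / 4 by positivity)
  filter_upwards [h.eventually_inner_lagrGrad_ge (show 0 < α / 4 by positivity),
    (continuous_fst.tendsto (xs, mus)).eventually ev]
  rintro ⟨x, mu⟩ h1 h2 y y' lam lam' hk hB hB' hlam
  simp only at h1 h2 hk hlam ⊢
  replace h1 := h1 hk.feas
  replace h2 := h2 hk.feas
  have h3 := hpen (x - xs) (y' - ys)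
  have hstat := hk.stat_next h.kkt.feas_lin hlam
  have hsub : P.lagrGrad x mu - P.lagrGrad xs mus
      = -mulV P.A.transpose (lam' - lams - ρ • mulV P.B (y' - y)) := by
    rw [eq_neg_of_add_eq_zero_left hstat, show P.lagrGrad xs mus = -mulV P.A.transpose lams from
      eq_neg_of_add_eq_zero_left h.kkt.stat_x, sub_right_comm lam', mulV_sub _ _ lams]
    abel
  rw [hsub, inner_neg_left, inner_mulV_transpose] at h1
  have hres := residual_eq h.kkt.feas_lin x y'
  have hA : mulV P.A (x - xs)
      = (1 / ρ) • ((lam' - lams) - (lam - lams)) - mulV P.B (y' - ys) := by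
    rw [hlam, hres]
    have : (1 / ρ) • (lam + ρ • (mulV P.A (x - xs) + mulV P.B (y' - ys)) - lams - (lam - lams))
        = (1 / ρ * ρ) • (mulV P.A (x - xs) + mulV P.B (y' - ys)) := by module
    rw [this, one_div_mul_cancel hρ.ne']
    module
  have hy : mulV P.B (y' - y) = mulV P.B (y' - ys) - mulV P.B (y - ys) := by
    rw [← mulV_sub]
    congr 1
    abel
  have hl : lam' - lam = (lam' - lams) - (lam - lams) := by abel
  -- Every multiplier difference is orthogonal to the range of `B`; this removes the mixed terms
  -- from the expansion of `h1`.
  have horth : ∀ (l : Vec q) (z : Vec m), mulV P.B.transpose l = 0 →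
      inner ℝ (l - lams) (mulV P.B z) = 0 := fun l z hl => by
    rw [← inner_mulV_transpose, mulV_sub, hl, h.kkt.stat_y, sub_zero, inner_zero_left]
  have o1 := horth lam (y - ys) hB
  have o2 := horth lam (y' - ys) hB
  have o3 := horth lam' (y - ys) hB'
  have o4 := horth lam' (y' - ys) hB'
  have hAB : mulV P.A (x - xs) + mulV P.B (y' - ys)
      = (1 / ρ) • ((lam' - lams) - (lam - lams)) := by rw [hA]; abel
  rw [hAB, norm_smul, mul_pow, Real.norm_eq_abs, sq_abs] at h3
  rw [hA, hy] at h1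
  rw [rhoNorm_sq hρ, rhoNorm_sq hρ, hy, hl]
  generalize x - xs = d at *
  generalize lam' - lams = v' at *
  generalize lam - lams = v at *
  generalize mulV P.B (y' - ys) = u' at *
  generalize mulV P.B (y - ys) = u at *
  simp only [inner_sub_left, inner_sub_right, inner_smul_left, inner_smul_right,
    real_inner_self_eq_norm_sq, real_inner_comm v' u', real_inner_comm v' u, real_inner_comm v u',
    real_inner_comm v u, o1, o2, o3, o4, RCLike.conj_to_real] at h1
  rw [norm_sub_sq_real] at h3
  rw [norm_sub_sq_real, norm_sub_sq_real, real_inner_comm u u']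
  have hi : ρ * (1 / ρ) = 1 := mul_one_div_cancel hρ.ne'
  generalize 1 / ρ = i at *
  -- Doubling matches the polarization identity. Of the `2α‖d‖²` from `h3`, the two estimates taken
  -- with `α / 4` use `α / 2` each, leaving `α‖d‖²`.
  linear_combination 2 * h3 + 2 * h1 + 2 * h2

end OverallRegularity

end Problem

end ADMM

/-! ### From vanishing decrements to convergence -/

namespace ADMM

theorem tendsto_zero_of_mul_norm_sq_le {E : Type*} [NormedAddCommGroup E] {c : ℝ} (hc : 0 < c)
    {a : ℕ → E} {g : ℕ → ℝ} (hg : Tendsto g atTop (𝓝 0)) (hle : ∀ j, c * ‖a j‖ ^ 2 ≤ g j) :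
    Tendsto a atTop (𝓝 0) := by
  have h1 : Tendsto (fun j => c⁻¹ * g j) atTop (𝓝 0) := by simpa using hg.const_mul c⁻¹
  have h2 : Tendsto (fun j => ‖a j‖ ^ 2) atTop (𝓝 0) :=
    squeeze_zero (fun j => by positivity) (fun j => by
      rw [le_inv_mul_iff₀ hc]
      exact hle j) h1
  have h3 := h2.sqrt
  simp only [Real.sqrt_zero, Real.sqrt_sq (norm_nonneg _)] at h3
  exact tendsto_zero_iff_norm_tendsto_zero.2 h3

theorem tendsto_sub_succ_of_antitone {E : ℕ → ℝ} (hE : Antitone E) (h0 : ∀ j, 0 ≤ E j) :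
    Tendsto (fun j => E j - E (j + 1)) atTop (𝓝 0) := by
  have hlim := tendsto_atTop_ciInf hE ⟨0, by rintro _ ⟨j, rfl⟩; exact h0 j⟩
  simpa using hlim.sub (hlim.comp (tendsto_add_atTop_nat 1))

/-- A nonnegative nonincreasing error that once reaches zero stays there; otherwise all the
quotients from `K` on are defined and at most `1`. -/
theorem finitely_many_or_qSublinear {e : ℕ → ℝ} {K : ℕ} (h0 : ∀ k, 0 ≤ e k)
    (hlim : Tendsto e atTop (𝓝 0)) (hmono : ∀ k ≥ K, e (k + 1) ≤ e k) :
    ConvergesInFinitelyMany e ∨ ConvergesQSublinearlyFrom K e := by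
  by_cases h : ∃ N ≥ K, e N = 0
  · obtain ⟨N, hN, hz⟩ := h
    refine Or.inl ⟨N, fun k hk => ?_⟩
    induction k, hk using Nat.le_induction with
    | base => exact hz
    | succ k hk ih => exact le_antisymm (ih ▸ hmono k (hN.trans hk)) (h0 _)
  · push Not at h
    exact Or.inr ⟨hlim, fun k hk => ⟨h k hk, div_le_one_of_le₀ (hmono k hk) (h0 k)⟩⟩

namespace Problem

variable {n m p q : ℕ} {P : Problem n m p q}

namespace OverallRegularity

variable {xs : Vec n} {ys : Vec m} {mus : Vec p} {lams : Vec q}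

/-- The weighted norm sees `y` only through `By`, but `B` is bounded below, so its balls shrink into
every neighbourhood of `(y*, λ*)`. -/
theorem exists_rhoNorm_lt_of_eventually (h : P.OverallRegularity xs ys mus lams) {ρ : ℝ}
    (hρ : 0 < ρ) {S : Vec m × Vec q → Prop} (hS : ∀ᶠ w in 𝓝 (ys, lams), S w) :
    ∃ R : ℝ, 0 < R ∧ ∀ y lam, P.rhoNorm ρ (y - ys) (lam - lams) < R → S (y, lam) := by
  obtain ⟨K, hK, hle⟩ := h.exists_norm_le_mulV_B
  obtain ⟨r, hr, hball⟩ := Metric.eventually_nhds_iff_ball.1 hS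
  have hs : 0 < Real.sqrt ρ := Real.sqrt_pos.2 hρ
  refine ⟨min (Real.sqrt ρ * r / K) (r / Real.sqrt ρ), by positivity, fun y lam hlt => ?_⟩
  obtain ⟨h1, h2⟩ := lt_min_iff.1 hlt
  refine hball _ ?_
  rw [mem_ball_iff_norm, Prod.mk_sub_mk, Prod.norm_mk, max_lt_iff]
  constructor
  · have h3 := (sqrt_mul_norm_le_rhoNorm (P := P) hρ (y - ys) (lam - lams)).trans_lt h1
    rw [lt_div_iff₀ hK, mul_assoc] at h3
    have h4 := lt_of_mul_lt_mul_left h3 hs.le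
    rw [mul_comm] at h4
    exact (hle _).trans_lt h4
  · rw [lt_div_iff₀ hs, mul_comm] at h2
    exact (norm_le_sqrt_mul_rhoNorm (P := P) hρ (y - ys) (lam - lams)).trans_lt h2

/-- If the increments of the iterates and the primal error in `x` vanish, so does the error. -/
theorem tendsto_rhoNorm_zero (h : P.OverallRegularity xs ys mus lams) {ρ δ : ℝ} (hρ : 0 < ρ)
    {x : ℕ → Vec n} {mu : ℕ → Vec p} {y y' : ℕ → Vec m} {lam lam' : ℕ → Vec q}
    (hk : ∀ j, P.IsSPKKT ρ (y j) (lam j) (x j) (mu j))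
    (hB' : ∀ j, mulV P.B.transpose (lam' j) = 0)
    (hlam : ∀ j, lam' j = lam j + ρ • P.residual (x j) (y' j)) (hmu : ∀ j, ‖mu j - mus‖ ≤ δ)
    (hx : Tendsto (fun j => x j - xs) atTop (𝓝 0))
    (hdy : Tendsto (fun j => mulV P.B (y' j - y j)) atTop (𝓝 0))
    (hdlam : Tendsto (fun j => lam' j - lam j) atTop (𝓝 0)) :
    Tendsto (fun j => P.rhoNorm ρ (y' j - ys) (lam' j - lams)) atTop (𝓝 0) := by
  obtain ⟨K, hK, hbound⟩ := h.exists_multiplier_bound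
  have hxs : Tendsto x atTop (𝓝 xs) := tendsto_sub_nhds_zero_iff.1 hx
  -- The multiplier update expresses `B(y' - y*)` as `(λ' - λ)/ρ - A(x - x*)`, and both terms
  -- vanish.
  have hu : Tendsto (fun j => mulV P.B (y' j - ys)) atTop (𝓝 0) := by
    have h1 : Tendsto (fun j => (1 / ρ) • (lam' j - lam j) - mulV P.A (x j - xs)) atTop
        (𝓝 ((1 / ρ) • 0 - mulV P.A 0)) :=
      (hdlam.const_smul _).sub (((continuous_mulV P.A).tendsto 0).comp hx)
    rw [smul_zero, mulV_zero, sub_zero] at h1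
    refine h1.congr fun j => ?_
    rw [hlam j, residual_eq h.kkt.feas_lin, add_sub_cancel_left, smul_smul,
      one_div_mul_cancel hρ.ne', one_smul, add_sub_cancel_left]
  have hadj : Continuous fun z => ContinuousLinearMap.adjoint (fderiv ℝ P.c z) :=
    ContinuousLinearMap.adjoint.continuous.comp (h.contDiff_c.continuous_fderiv one_ne_zero)
  -- Convergence of `μ` is not available at this point; boundedness suffices to move the Jacobian to
  -- `x*`.
  have hJ : Tendsto (fun j => P.gradCMul (x j) (mu j) - P.gradCMul xs (mu j)) atTop (𝓝 0) := by
    have h1 : Tendsto (fun j => ‖ContinuousLinearMap.adjoint (fderiv ℝ P.c (x j))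
        - ContinuousLinearMap.adjoint (fderiv ℝ P.c xs)‖ * (δ + ‖mus‖)) atTop (𝓝 0) := by
      have h2 := (hadj.tendsto xs).comp hxs
      have h3 := (tendsto_sub_nhds_zero_iff.2 h2).norm.mul_const (δ + ‖mus‖)
      simpa using h3
    refine squeeze_zero_norm (fun j => ?_) h1
    rw [gradCMul_eq_adjoint (h.diff_c _), gradCMul_eq_adjoint (h.diff_c _), ← sub_apply]
    refine (ContinuousLinearMap.le_opNorm _ _).trans ?_
    gcongr
    have h4 := norm_add_le (mu j - mus) mus
    rw [sub_add_cancel] at h4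
    linarith [hmu j]
  have hf : Tendsto (fun j => gradient P.f (x j) - gradient P.f xs) atTop (𝓝 0) :=
    tendsto_sub_nhds_zero_iff.2 ((h.continuous_gradient.tendsto xs).comp hxs)
  have hAB : Tendsto (fun j => ρ • mulV P.A.transpose (mulV P.B (y' j - y j))) atTop (𝓝 0) := by
    have h1 := (((continuous_mulV P.A.transpose).tendsto 0).comp hdy).const_smul ρ
    rw [mulV_zero, smul_zero] at h1
    exact h1
  have hstat : Tendsto (fun j => P.gradCMul xs (mu j - mus)
      + mulV P.A.transpose (lam' j - lams)) atTop (𝓝 0) := by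
    have h1 := (hAB.sub hf).sub hJ
    rw [sub_zero, sub_zero] at h1
    refine h1.congr fun j => ?_
    have e1 := (hk j).stat_next h.kkt.feas_lin (hlam j)
    have e2 := h.kkt.stat_x
    rw [lagrGrad, mulV_sub, mulV_smul] at e1
    have e3 : P.gradCMul xs (mu j - mus) = P.gradCMul xs (mu j) - P.gradCMul xs mus := by
      simp only [gradCMul_eq_adjoint (h.diff_c xs), map_sub]
    rw [e3, mulV_sub _ (lam' j), ← sub_eq_zero]
    have e4 := congrArg₂ (· - ·) e2 e1
    simp only [sub_zero] at e4
    rw [← e4]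
    abel
  have hv : Tendsto (fun j => lam' j - lams) atTop (𝓝 0) := by
    have h1 := hstat.norm.const_mul K
    rw [norm_zero, mul_zero] at h1
    refine squeeze_zero_norm (fun j => (hbound (mu j - mus) (lam' j - lams) ?_).2) h1
    rw [mulV_sub, hB' j, h.kkt.stat_y, sub_zero]
  have hsq : Tendsto (fun j => ρ * ‖mulV P.B (y' j - ys)‖ ^ 2 + 1 / ρ * ‖lam' j - lams‖ ^ 2)
      atTop (𝓝 0) := by
    simpa using ((hu.norm.pow 2).const_mul ρ).add ((hv.norm.pow 2).const_mul (1 / ρ))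
  simpa [rhoNorm] using hsq.sqrt

end OverallRegularity

end Problem

end ADMM

/-! ### Assembly of the corollary -/

theorem mainTheorem5 {n m p q : ℕ} (P : ADMM.Problem n m p q)
    (xs : ADMM.Vec n) (ys : ADMM.Vec m) (mus : ADMM.Vec p) (lams : ADMM.Vec q)
    (hreg : P.OverallRegularity xs ys mus lams) :
    ∃ ρs : ℝ, 0 < ρs ∧ ∀ ρ : ℝ, ρs < ρ → ∃ ε : ℝ, 0 < ε ∧
      ∀ (x : ℕ → ADMM.Vec n) (y : ℕ → ADMM.Vec m) (mu : ℕ → ADMM.Vec p) (lam : ℕ → ADMM.Vec q),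
        P.IsADMM ρ x y lam →
        P.KKTIterates ρ x y mu lam →
        P.NearestSolution ρ xs mus x y mu lam →
        ∀ K : ℕ, ADMM.pairNorm (y K - ys) (lam K - lams) < ε →
          Tendsto (fun k => P.rhoNorm ρ (y k - ys) (lam k - lams)) atTop (𝓝 0) ∧
          (∀ k ≥ K, P.rhoNorm ρ (y (k + 1) - ys) (lam (k + 1) - lams)
            ≤ P.rhoNorm ρ (y k - ys) (lam k - lams)) ∧
          (ADMM.ConvergesInFinitelyMany
              (fun k => P.rhoNorm ρ (y k - ys) (lam k - lams)) ∨
            ADMM.ConvergesQSublinearlyFrom K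
              (fun k => P.rhoNorm ρ (y k - ys) (lam k - lams))) := by
  obtain ⟨σ, α, hσ, hα, hpen⟩ := hreg.exists_penalty
  refine ⟨2 * σ, by positivity, fun ρ hρσ => ?_⟩
  have hρ : 0 < ρ := by linarith
  have hτ : 0 < 1 / ρ - 2 * σ * (1 / ρ) ^ 2 := by
    have h1 : 1 / ρ - 2 * σ * (1 / ρ) ^ 2 = (ρ - 2 * σ) / ρ ^ 2 := by field_simp
    rw [h1]
    have : 0 < ρ - 2 * σ := by linarith
    positivity
  obtain ⟨δ, hδ, hdesc⟩ := Metric.eventually_nhds_iff_ball.1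
    (hreg.eventually_descent hσ hα hpen hρ)
  -- Radius `δ / 2` in each component keeps the stacked norm of the nearby pair below `δ`; the
  -- nearest pair is no farther away.
  obtain ⟨R, hR, hnear⟩ := hreg.exists_rhoNorm_lt_of_eventually hρ
    (hreg.eventually_exists_minMultiplier
      (hreg.spObj_growth hσ hα hpen (by linarith : σ ≤ ρ)) (half_pos hδ))
  -- The trapping region is a ball of radius `R` in the weighted norm, the norm that decreases; `ε`
  -- only converts the Euclidean starting condition into it.
  obtain ⟨ε, hε, hstart⟩ := Metric.eventually_nhds_iff_ball.1
    (ADMM.Problem.eventually_rhoNorm_lt (P := P) ρ ys lams hR)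
  refine ⟨ε, hε, fun x y mu lam hadmm hkkt hclose K hK => ?_⟩
  have hB := hadmm.transpose_mulV_eq_zero
  have hloc : ∀ k, P.rhoNorm ρ (y k - ys) (lam k - lams) < R →
      (x (k + 1), mu (k + 1)) ∈ Metric.ball (xs, mus) δ := fun k hk => by
    obtain ⟨x', mu', hsol, hx', hmu'⟩ := hnear _ _ hk
    have h1 : ADMM.pairNorm (x (k + 1) - xs) (mu (k + 1) - mus) < δ :=
      ((hclose k).2 x' mu' hsol).trans_lt
        ((ADMM.pairNorm_le_add _ _).trans_lt (by linarith))
    rw [mem_ball_iff_norm, Prod.mk_sub_mk, Prod.norm_mk, max_lt_iff]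
    exact ⟨(ADMM.norm_left_le_pairNorm _ _).trans_lt h1,
      (ADMM.norm_right_le_pairNorm _ _).trans_lt h1⟩
  have hstep : ∀ k, P.rhoNorm ρ (y k - ys) (lam k - lams) < R →
      P.rhoNorm ρ (y (k + 1) - ys) (lam (k + 1) - lams) ^ 2
        + (α * ‖x (k + 1) - xs‖ ^ 2 + ρ * ‖ADMM.mulV P.B (y (k + 1) - y k)‖ ^ 2
        + (1 / ρ - 2 * σ * (1 / ρ) ^ 2) * ‖lam (k + 1) - lam k‖ ^ 2)
      ≤ P.rhoNorm ρ (y k - ys) (lam k - lams) ^ 2 := fun k hk =>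
    hdesc _ (hloc k hk) _ _ _ _ (hkkt k) (hB k) (hB (k + 1)) (hadmm.lam_step k)
  have hle : ∀ k, P.rhoNorm ρ (y k - ys) (lam k - lams) < R →
      P.rhoNorm ρ (y (k + 1) - ys) (lam (k + 1) - lams)
        ≤ P.rhoNorm ρ (y k - ys) (lam k - lams) := fun k hk => by
    refine le_of_sq_le_sq (le_trans (le_add_of_nonneg_right ?_) (hstep k hk))
      (ADMM.Problem.rhoNorm_nonneg _ _ _)
    positivity
  have hsmall : ∀ k ≥ K, P.rhoNorm ρ (y k - ys) (lam k - lams) < R := fun k hk => by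
    induction k, hk using Nat.le_induction with
    | base =>
      refine hstart (y K, lam K) ?_
      rw [mem_ball_iff_norm, Prod.mk_sub_mk, Prod.norm_mk, max_lt_iff]
      exact ⟨(ADMM.norm_left_le_pairNorm _ _).trans_lt hK,
        (ADMM.norm_right_le_pairNorm _ _).trans_lt hK⟩
    | succ k hk ih => exact (hle k ih).trans_lt ih
  have hmono : ∀ k ≥ K, P.rhoNorm ρ (y (k + 1) - ys) (lam (k + 1) - lams)
      ≤ P.rhoNorm ρ (y k - ys) (lam k - lams) := fun k hk => hle k (hsmall k hk)
  have hdiff := ADMM.tendsto_sub_succ_of_antitone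
    (E := fun j => P.rhoNorm ρ (y (j + K) - ys) (lam (j + K) - lams) ^ 2)
    (antitone_nat_of_succ_le fun j => by
      have h1 := hmono (j + K) (Nat.le_add_left K j)
      rw [add_right_comm]
      exact pow_le_pow_left₀ (ADMM.Problem.rhoNorm_nonneg _ _ _) h1 2)
    (fun j => sq_nonneg _)
  have hdec : ∀ j, α * ‖x (j + K + 1) - xs‖ ^ 2
        + ρ * ‖ADMM.mulV P.B (y (j + K + 1) - y (j + K))‖ ^ 2
        + (1 / ρ - 2 * σ * (1 / ρ) ^ 2) * ‖lam (j + K + 1) - lam (j + K)‖ ^ 2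
      ≤ P.rhoNorm ρ (y (j + K) - ys) (lam (j + K) - lams) ^ 2
        - P.rhoNorm ρ (y (j + 1 + K) - ys) (lam (j + 1 + K) - lams) ^ 2 := fun j => by
    have h1 := hstep (j + K) (hsmall _ (Nat.le_add_left K j))
    rw [add_right_comm j 1 K]
    linarith
  have hterms : ∀ j, 0 ≤ α * ‖x (j + K + 1) - xs‖ ^ 2
      ∧ 0 ≤ ρ * ‖ADMM.mulV P.B (y (j + K + 1) - y (j + K))‖ ^ 2
      ∧ 0 ≤ (1 / ρ - 2 * σ * (1 / ρ) ^ 2) * ‖lam (j + K + 1) - lam (j + K)‖ ^ 2 :=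
    fun j => ⟨by positivity, by positivity, by positivity⟩
  have hconv : Tendsto (fun k => P.rhoNorm ρ (y k - ys) (lam k - lams)) atTop (𝓝 0) := by
    -- The shift is `K + 1` because the limit lemma concerns the new iterates, and the first
    -- controlled step goes from `K` to `K + 1`.
    rw [← tendsto_add_atTop_iff_nat (K + 1)]
    exact hreg.tendsto_rhoNorm_zero hρ (δ := δ) (x := fun j => x (j + K + 1))
      (mu := fun j => mu (j + K + 1)) (y := fun j => y (j + K)) (y' := fun j => y (j + K + 1))
      (lam := fun j => lam (j + K)) (lam' := fun j => lam (j + K + 1))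
      (fun j => hkkt (j + K)) (fun j => hB _) (fun j => hadmm.lam_step (j + K))
      (fun j => by
        have h1 := hloc (j + K) (hsmall _ (Nat.le_add_left K j))
        rw [mem_ball_iff_norm, Prod.mk_sub_mk, Prod.norm_mk, max_lt_iff] at h1
        exact h1.2.le)
      (ADMM.tendsto_zero_of_mul_norm_sq_le hα hdiff fun j => by
        linarith [hdec j, hterms j])
      (ADMM.tendsto_zero_of_mul_norm_sq_le hρ hdiff fun j => by
        linarith [hdec j, hterms j])
      (ADMM.tendsto_zero_of_mul_norm_sq_le hτ hdiff fun j => by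
        linarith [hdec j, hterms j])
  exact ⟨hconv, hmono, ADMM.finitely_many_or_qSublinear
    (fun k => ADMM.Problem.rhoNorm_nonneg _ _ _) hconv hmono⟩
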